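/- For $n\ge 0$ let $T(n)$ be the number of triples $(x,y,z)$ of pairwise commuting elements of the symmetric group $S_n$ (with $S_0$ trivial), and for $j\ge 1$ let $\sigma(j)=\sum_{a\mid j}a$. Then the following hold. 1. For every complex $u$ with $|u|<1$ the infinite product $F(u)=\prod_{j=1}^{\infty}(1-u^j)^{-\sigma(j)}$ converges unconditionally to a nonzero limit, the series $\sum_{n=0}^{\infty}\frac{T(n)}{n!}u^n$ converges absolutely, and $$\prod_{j=1}^{\infty}(1-u^j)^{-\sigma(j)}=\sum_{n=0}^{\infty}\frac{T(n)}{n!}u^n .$$ 2. The function $F$ is analytic on the open unit disc, and $\sum_{n\ge 0}\frac{T(n)}{n!}u^n$ is its Taylor series at $0$, i.e. $F^{(n)}(0)/n!=T(n)/n!$ for all $n\ge 0$. 3. The power series $L(u)=\sum_{d=1}^{\infty}\Bigl(\sum_{a\mid d}\frac{a\,\sigma(a)}{d}\Bigr)u^d$ has radius of convergence exactly $1$. For $|u|<1$ one has $L(u)=\sum_{j\ge 1}\sum_{k\ge 1}\frac{\sigma(j)}{k}u^{jk}$, where the double series converges absolutely, and $\exp(L(u))=F(u)$. 4. The sequence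 $T(n)/n!$ grows subexponentially: for every real $c>1$, $T(n)/n!=o(c^n)$ as $n\to\infty$. -/

import Mathlib

open scoped Nat

noncomputable section

namespace CommutingTriples

/-- The number of triples of pairwise commuting elements of the symmetric group on `n` letters. -/
def T (n : ℕ) : ℕ :=
  Nat.card {p : Equiv.Perm (Fin n) × Equiv.Perm (Fin n) × Equiv.Perm (Fin n) //
    Commute p.1 p.2.1 ∧ Commute p.1 p.2.2 ∧ Commute p.2.1 p.2.2}

/-- The sum of the divisors of `j`. -/
def sigmaOne (j : ℕ) : ℕ := ArithmeticFunction.sigma 1 j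

/-- The factor `(1 - u ^ j) ^ (-σ(j))`, for a positive integer `j`. -/
def factor (u : ℂ) (j : ℕ+) : ℂ := (1 - u ^ (j : ℕ)) ^ (-(sigmaOne j : ℤ))

/-- The infinite product of `(1 - u ^ j) ^ (-σ(j))` over all `j ≥ 1`. -/
def productSide (u : ℂ) : ℂ := ∏' j : ℕ+, factor u j

/-- The coefficient `∑_{a ∣ d} a σ(a) / d` of `u ^ d` in the logarithm series
(there is no constant term: the value at `d = 0` is an empty sum). -/
def logCoeff (d : ℕ) : ℂ := ∑ a ∈ d.divisors, ((a : ℂ) * (sigmaOne a : ℂ)) / (d : ℂ)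

/-- The logarithm series evaluated at `u`. -/
def logSeries (u : ℂ) : ℂ := ∑' d : ℕ, logCoeff d * u ^ d

/-- A real sequence grows subexponentially if it is `o(c ^ n)` for every `c > 1`. -/
def SubexponentialGrowth (f : ℕ → ℝ) : Prop :=
  ∀ c : ℝ, 1 < c → f =o[Filter.atTop] (fun n : ℕ => c ^ n)

end CommutingTriples

end

/-! A commuting triple in `S_n` is a homomorphism `ℤ³ → S_n`, that is, an action of `ℤ³` on `n`
points. Marking a point and splitting off its orbit, a coset space of the stabilizer, gives `n T(n)
= ∑_d s(d) · n(n-1)⋯(n-d+1) · T(n-d)`, where `s(d)` counts the index-`d` subgroups of `ℤ³`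
(`card_mul_actionCount`). Slicing a subgroup of `H × ℤ` along `H` yields `s(d) = ∑_{a ∣ d} a σ(a)`,
which is `d` times the coefficient of `u^d` in `L` (`card_addSubgroup_int_cubed`).

On the analytic side, the double series of terms `σ(j) u^{jk} / k` converges absolutely. Summed over
`k` first it gives the logarithm of the product; grouped by `d = jk` it gives `L`. Hence `F = exp
L`, and the Leibniz rule for `F' = F L'` gives the Taylor coefficients of `F` the same recursion as
`T`, with the same initial value `1` (`iteratedDeriv_productSide`). -/

namespace CommutingTriples

/-! ### Counting subgroups of given index in `ℤ³` -/

section Sublattices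

variable {H : Type*} [AddCommGroup H]

/-- The subgroup of `H × ℤ` generated by `K × 0` and `(x, b)`, for a class `x` modulo `K`. -/
def extendSubgroup (K : AddSubgroup H) (b : ℕ) (x : H ⧸ K) : AddSubgroup (H × ℤ) where
  carrier := {p | ∃ k : ℤ, p.2 = k * b ∧ (p.1 : H ⧸ K) = k • x}
  zero_mem' := ⟨0, by simp⟩
  add_mem' := by
    rintro p q ⟨k, hk, hk'⟩ ⟨l, hl, hl'⟩
    exact ⟨k + l, by simp [hk, hl, add_mul], by simp [hk', hl', add_smul]⟩
  neg_mem' := by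
    rintro p ⟨k, hk, hk'⟩
    exact ⟨-k, by simp [hk], by simp [hk']⟩

theorem mem_extendSubgroup {K : AddSubgroup H} {b : ℕ} {x : H ⧸ K} {p : H × ℤ} :
    p ∈ extendSubgroup K b x ↔ ∃ k : ℤ, p.2 = k * b ∧ (p.1 : H ⧸ K) = k • x := Iff.rfl

/-- The index factors through `L + H × 0`, where `H × 0` is the kernel of the projection to `ℤ`. -/
theorem index_eq_comap_inl_mul_map_snd (L : AddSubgroup (H × ℤ)) :
    L.index = (L.comap (AddMonoidHom.inl H ℤ)).index *
      (L.map (AddMonoidHom.snd H ℤ)).index := by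
  have hker : (AddMonoidHom.inl H ℤ).range = (AddMonoidHom.snd H ℤ).ker := by
    ext ⟨h, m⟩
    rw [AddMonoidHom.mem_ker]
    simp [eq_comm]
  have hsurj : (AddMonoidHom.snd H ℤ).range.index = 1 := by
    rw [AddMonoidHom.range_eq_top_of_surjective _ Prod.snd_surjective, AddSubgroup.index_top]
  rw [AddSubgroup.index_comap, AddSubgroup.index_map, hsurj, mul_one, hker,
    ← AddSubgroup.relIndex_sup_right, sup_comm,
    AddSubgroup.relIndex_mul_index le_sup_left]

theorem comap_inl_extendSubgroup (K : AddSubgroup H) {b : ℕ} (hb : b ≠ 0) (x : H ⧸ K) :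
    (extendSubgroup K b x).comap (AddMonoidHom.inl H ℤ) = K := by
  ext h
  simp only [AddSubgroup.mem_comap, mem_extendSubgroup, AddMonoidHom.inl_apply]
  constructor
  · rintro ⟨k, hk, hk'⟩
    obtain rfl : k = 0 := by simpa [hb] using hk.symm
    simpa using hk'
  · intro hh
    exact ⟨0, by simp, by simpa using hh⟩

theorem map_snd_extendSubgroup (K : AddSubgroup H) (b : ℕ) (x : H ⧸ K) :
    (extendSubgroup K b x).map (AddMonoidHom.snd H ℤ) = AddSubgroup.zmultiples (b : ℤ) := by
  ext m
  simp only [AddSubgroup.mem_map, mem_extendSubgroup, AddMonoidHom.coe_snd, Prod.exists,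
    AddSubgroup.mem_zmultiples_iff, smul_eq_mul]
  constructor
  · rintro ⟨h, l, ⟨k, hk, -⟩, rfl⟩
    exact ⟨k, hk.symm⟩
  · rintro ⟨k, rfl⟩
    obtain ⟨h, hh⟩ := QuotientAddGroup.mk_surjective (k • x)
    exact ⟨h, _, ⟨k, rfl, hh⟩, rfl⟩

theorem index_extendSubgroup (K : AddSubgroup H) {b : ℕ} (hb : b ≠ 0) (x : H ⧸ K) :
    (extendSubgroup K b x).index = K.index * b := by
  rw [index_eq_comap_inl_mul_map_snd, comap_inl_extendSubgroup K hb, map_snd_extendSubgroup,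
    Int.index_zmultiples, Int.natAbs_natCast]

theorem extendSubgroup_injective (K : AddSubgroup H) {b : ℕ} (hb : b ≠ 0) :
    Function.Injective (extendSubgroup K b) := by
  intro x y hxy
  obtain ⟨h, rfl⟩ := QuotientAddGroup.mk_surjective x
  have hmem : (h, (b : ℤ)) ∈ extendSubgroup K b (h : H ⧸ K) := ⟨1, by simp, by simp⟩
  rw [hxy] at hmem
  obtain ⟨k, hk, hk'⟩ := hmem
  obtain rfl : k = 1 := by
    have : (b : ℤ) ≠ 0 := by exact_mod_cast hb
    exact mul_right_cancel₀ this (by simpa using hk.symm)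
  simpa using hk'

/-- The trivial subgroup is covered by the convention that an infinite index is `0`. -/
theorem eq_zmultiples_index (M : AddSubgroup ℤ) : M = AddSubgroup.zmultiples (M.index : ℤ) := by
  obtain ⟨a, ha⟩ := Int.subgroup_cyclic M
  rw [← AddSubgroup.zmultiples_eq_closure] at ha
  rw [ha, Int.index_zmultiples, Int.zmultiples_natAbs]

/-- The projection of `L` to `ℤ` is cyclic; lift its generator `b` to `(x, b) ∈ L`. Then `(h, kb) ∈
L` exactly when `h - kx` lies in the slice `L ∩ H`, so only the class of `x` matters. -/
theorem exists_eq_extendSubgroup (L : AddSubgroup (H × ℤ)) :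
    ∃ x, L = extendSubgroup (L.comap (AddMonoidHom.inl H ℤ))
      (L.map (AddMonoidHom.snd H ℤ)).index x := by
  set M := L.map (AddMonoidHom.snd H ℤ) with hM
  have hMz := eq_zmultiples_index M
  have hmem : (M.index : ℤ) ∈ M := hMz.ge (AddSubgroup.mem_zmultiples _)
  obtain ⟨⟨x, c⟩, hx, rfl : c = _⟩ := hmem
  refine ⟨(x : H ⧸ _), ?_⟩
  ext ⟨h, m⟩
  have key (k : ℤ) : (h, k * (M.index : ℤ)) ∈ L ↔
      (h : H ⧸ L.comap (AddMonoidHom.inl H ℤ)) = k • (x : H ⧸ _) := by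
    rw [← QuotientAddGroup.mk_zsmul, eq_comm, QuotientAddGroup.eq, AddSubgroup.mem_comap,
      ← AddSubgroup.add_mem_cancel_left L (L.neg_mem (L.zsmul_mem hx k))]
    simp
  rw [mem_extendSubgroup]
  constructor
  · intro hL
    have hm : m ∈ M := ⟨_, hL, rfl⟩
    rw [hMz, AddSubgroup.mem_zmultiples_iff] at hm
    obtain ⟨k, rfl⟩ := hm
    exact ⟨k, rfl, (key k).1 hL⟩
  · rintro ⟨k, rfl : m = _, hk⟩
    exact (key k).2 hk

/-- The subgroups of index `d` of `H × ℤ`, parametrised by a subgroup `K` of `H` whose index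
divides `d` and a class modulo `K`. -/
def extendOfIndex (d : ℕ) (hd : d ≠ 0)
    (p : Σ a : d.divisors, Σ K : {K : AddSubgroup H // K.index = a}, H ⧸ K.1) :
    {L : AddSubgroup (H × ℤ) // L.index = d} :=
  ⟨extendSubgroup p.2.1.1 (d / p.1) p.2.2, by
    have hdvd := Nat.dvd_of_mem_divisors p.1.2
    rw [index_extendSubgroup _ (Nat.div_ne_zero_iff_of_dvd hdvd |>.2
      ⟨hd, (Nat.pos_of_mem_divisors p.1.2).ne'⟩), p.2.1.2, Nat.mul_div_cancel' hdvd]⟩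

theorem extendOfIndex_bijective (d : ℕ) (hd : d ≠ 0) :
    Function.Bijective (extendOfIndex (H := H) d hd) := by
  constructor
  · rintro ⟨⟨a, ha⟩, ⟨K, rfl : K.index = a⟩, x⟩ ⟨⟨a', ha'⟩, ⟨K', rfl : K'.index = a'⟩, x'⟩ h
    have hne {a : ℕ} (ha : a ∈ d.divisors) : d / a ≠ 0 :=
      (Nat.div_ne_zero_iff_of_dvd (Nat.dvd_of_mem_divisors ha)).2
        ⟨hd, (Nat.pos_of_mem_divisors ha).ne'⟩
    replace h : extendSubgroup K (d / K.index) x = extendSubgroup K' (d / K'.index) x' :=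
      congrArg Subtype.val h
    obtain rfl : K = K' := by
      rw [← comap_inl_extendSubgroup K (hne ha) x, h, comap_inl_extendSubgroup K' (hne ha') x']
    rw [extendSubgroup_injective K (hne ha) h]
  · rintro ⟨L, rfl⟩
    obtain ⟨x, hx⟩ := exists_eq_extendSubgroup L
    have hidx := index_eq_comap_inl_mul_map_snd L
    have h0 : (L.comap (AddMonoidHom.inl H ℤ)).index ≠ 0 := fun h => hd (by rw [hidx, h, zero_mul])
    refine ⟨⟨⟨_, Nat.mem_divisors.2 ⟨⟨_, hidx⟩, hd⟩⟩, ⟨_, rfl⟩, x⟩, Subtype.ext ?_⟩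
    have hdiv := Nat.div_eq_of_eq_mul_right (Nat.pos_of_ne_zero h0) hidx
    change extendSubgroup _ (L.index / (L.comap (AddMonoidHom.inl H ℤ)).index) x = L
    rw [hdiv]
    exact hx.symm

theorem finite_addSubgroup_prod_int
    (hfin : ∀ a ≠ 0, Finite {K : AddSubgroup H // K.index = a}) (d : ℕ) (hd : d ≠ 0) :
    Finite {L : AddSubgroup (H × ℤ) // L.index = d} := by
  have (a : d.divisors) : Finite {K : AddSubgroup H // K.index = a} :=
    hfin a (Nat.pos_of_mem_divisors a.2).ne'
  have (a : d.divisors) (K : {K : AddSubgroup H // K.index = a}) : Finite (H ⧸ K.1) :=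
    AddSubgroup.index_ne_zero_iff_finite.1 
      (K.2.trans_ne (Nat.pos_of_mem_divisors a.2).ne')
  exact Finite.of_surjective _ (extendOfIndex_bijective d hd).2

/-- The weight `a` is the number of classes modulo a slice `K` of index `a`. -/
theorem card_addSubgroup_prod_int
    (hfin : ∀ a ≠ 0, Finite {K : AddSubgroup H // K.index = a}) (d : ℕ) (hd : d ≠ 0) :
    Nat.card {L : AddSubgroup (H × ℤ) // L.index = d} =
      ∑ a ∈ d.divisors, a * Nat.card {K : AddSubgroup H // K.index = a} := by
  have (a : d.divisors) : Finite {K : AddSubgroup H // K.index = a} :=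
    hfin a (Nat.pos_of_mem_divisors a.2).ne'
  have (a : d.divisors) (K : {K : AddSubgroup H // K.index = a}) : Finite (H ⧸ K.1) :=
    AddSubgroup.index_ne_zero_iff_finite.1 
      (K.2.trans_ne (Nat.pos_of_mem_divisors a.2).ne')
  rw [← Nat.card_congr (Equiv.ofBijective _ (extendOfIndex_bijective d hd)), Nat.card_sigma,
    ← Finset.sum_coe_sort d.divisors]
  refine Finset.sum_congr rfl fun a _ => ?_
  have := Fintype.ofFinite {K : AddSubgroup H // K.index = a}
  rw [Nat.card_sigma, Finset.sum_congr rfl (g := fun _ => (a : ℕ)) fun K _ => K.2]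
  simp [mul_comm]

theorem card_addSubgroup_int (a : ℕ) :
    Nat.card {K : AddSubgroup ℤ // K.index = a} = 1 := by
  rw [Nat.card_eq_one_iff_unique]
  refine ⟨⟨?_⟩, ⟨⟨AddSubgroup.zmultiples (a : ℤ), by simp [Int.index_zmultiples]⟩⟩⟩
  rintro ⟨K, rfl⟩ ⟨K', h⟩
  apply Subtype.ext
  change K = K'
  rw [eq_zmultiples_index K, eq_zmultiples_index K', h]

theorem finite_addSubgroup_int (a : ℕ) : Finite {K : AddSubgroup ℤ // K.index = a} :=
  Nat.finite_of_card_ne_zero (by simp [card_addSubgroup_int])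

theorem finite_addSubgroup_int_cubed (d : ℕ) (hd : d ≠ 0) :
    Finite {L : AddSubgroup ((ℤ × ℤ) × ℤ) // L.index = d} :=
  finite_addSubgroup_prod_int
    (finite_addSubgroup_prod_int fun a _ => finite_addSubgroup_int a) d hd

theorem card_addSubgroup_int_cubed (d : ℕ) (hd : d ≠ 0) :
    Nat.card {L : AddSubgroup ((ℤ × ℤ) × ℤ) // L.index = d} =
      ∑ a ∈ d.divisors, a * sigmaOne a := by
  rw [card_addSubgroup_prod_int
    (finite_addSubgroup_prod_int fun a _ => finite_addSubgroup_int a) d hd]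
  refine Finset.sum_congr rfl fun a ha => ?_
  rw [card_addSubgroup_prod_int (fun a _ => finite_addSubgroup_int a) a
    (Nat.pos_of_mem_divisors ha).ne', sigmaOne, ArithmeticFunction.sigma_one_apply]
  simp [card_addSubgroup_int]

end Sublattices

/-! ### Group actions on finite sets and the marked-point recursion -/

section Actions

variable {G : Type*} [Group G]

section Extension

variable {X Y : Type*}

open Classical in
/-- A type is the disjoint union of the image of an embedding and its complement. -/
noncomputable def sumComplRange (ι : Y ↪ X) : Y ⊕ ((Set.range ι)ᶜ : Set X) ≃ X :=
  ((Equiv.ofInjective ι ι.injective).sumCongr (Equiv.refl _)).trans (Equiv.Set.sumCompl _)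

@[simp]
theorem sumComplRange_inl (ι : Y ↪ X) (y : Y) : sumComplRange ι (Sum.inl y) = ι y := by
  simp [sumComplRange]

variable [MulAction G Y]

/-- Extend the action on the image of an embedding by an action on the complement. -/
noncomputable def extendAction (ι : Y ↪ X) (h : G →* Equiv.Perm ((Set.range ι)ᶜ : Set X)) :
    {f : G →* Equiv.Perm X // ∀ g y, f g (ι y) = ι (g • y)} :=
  ⟨(sumComplRange ι).permCongrHom.toMonoidHom.comp
    ((Equiv.Perm.sumCongrHom _ _).comp ((MulAction.toPermHom G Y).prod h)), fun g y => by
      have hy : (sumComplRange ι).symm (ι y) = Sum.inl y := by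
        rw [Equiv.symm_apply_eq, sumComplRange_inl]
      simp [Equiv.permCongrHom, Equiv.permCongr_apply, hy]⟩

/-- On a finite set, a permutation mapping the image of `ι` into itself splits as a permutation of
the image and one of the complement. The first part is prescribed, the second is free. -/
theorem extendAction_bijective [Finite X] (ι : Y ↪ X) :
    Function.Bijective (extendAction (G := G) ι) := by
  constructor
  · intro h h' hh
    have h1 := congrArg Subtype.val hh
    ext1 g
    have h2 := Equiv.Perm.sumCongrHom_injective
      ((sumComplRange ι).permCongrHom.injective (DFunLike.congr_fun h1 g))
    exact congrArg Prod.snd h2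
  · rintro ⟨f, hf⟩
    have : Finite Y := Finite.of_injective ι ι.injective
    set e := sumComplRange ι with he
    have hrange (g : G) : ∃ p, Equiv.Perm.sumCongrHom _ _ p = e.permCongrHom.symm (f g) := by
      apply Equiv.Perm.mem_sumCongrHom_range_of_perm_mapsTo_inl
      rintro _ ⟨y, rfl⟩
      refine ⟨g • y, e.injective ?_⟩
      simp [he, Equiv.permCongrHom, Equiv.permCongr_apply, hf]
    choose p hp using hrange
    have hp1 (g : G) : (p g).1 = MulAction.toPermHom G Y g := by
      ext y
      have h1 := congrArg e (DFunLike.congr_fun (hp g) (Sum.inl y))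
      apply ι.injective
      simpa [he, Equiv.permCongrHom, Equiv.permCongr_apply, hf] using h1
    have hpmul (g g' : G) : p (g * g') = p g * p g' :=
      Equiv.Perm.sumCongrHom_injective (by rw [map_mul, hp, hp, hp, map_mul, map_mul])
    refine ⟨MonoidHom.mk' (fun g => (p g).2) fun g g' => by rw [hpmul]; rfl, Subtype.ext ?_⟩
    ext1 g
    have h2 : (MulAction.toPermHom G Y g, (p g).2) = p g := by rw [← hp1]
    change e.permCongrHom (Equiv.Perm.sumCongrHom _ _ (MulAction.toPermHom G Y g, (p g).2)) = f g
    rw [h2, hp, MulEquiv.apply_symm_apply]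

end Extension

/-- The number of actions of a group on `n` points. -/
noncomputable def actionCount (G : Type*) [Group G] (n : ℕ) : ℕ :=
  Nat.card (G →* Equiv.Perm (Fin n))

theorem card_hom_perm (X : Type*) [Finite X] :
    Nat.card (G →* Equiv.Perm X) = actionCount G (Nat.card X) :=
  Nat.card_congr ((Finite.equivFin X).permCongrHom.monoidHomCongrRightEquiv)

/-- A pointed action restricts to an equivariant embedding of a coset space. -/
def pointedAction (G : Type*) [Group G] (X : Type*) (s : Finset ℕ)
    (p : Σ d : s, Σ S : {S : Subgroup G // S.index = d}, Σ ι : (G ⧸ S.1) ↪ X,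
      {f : G →* Equiv.Perm X // ∀ g c, f g (ι c) = ι (g • c)}) :
    (G →* Equiv.Perm X) × X :=
  (p.2.2.2.1, p.2.2.1 ((1 : G) : G ⧸ p.2.1.1))

/-- Orbit-stabilizer: `S` must be the stabilizer of the marked point and `ι` its orbit map. -/
theorem pointedAction_bijective (X : Type*) [Finite X] :
    Function.Bijective (pointedAction G X (Finset.Icc 1 (Nat.card X))) := by
  constructor
  · rintro ⟨⟨d, hd⟩, ⟨S, rfl : S.index = d⟩, ι, f, hf⟩
      ⟨⟨d', hd'⟩, ⟨S', rfl : S'.index = d'⟩, ι', f', hf'⟩ h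
    obtain ⟨rfl : f = f', h1 : ι (1 : G) = ι' (1 : G)⟩ := Prod.ext_iff.1 h
    have hmk {S : Subgroup G} {ι : (G ⧸ S) ↪ X} (hf : ∀ g c, f g (ι c) = ι (g • c)) (g : G) :
        ι (g : G ⧸ S) = f g (ι (1 : G)) := by
      rw [hf, MulAction.Quotient.smul_coe, smul_eq_mul, mul_one]
    have hstab {S : Subgroup G} {ι : (G ⧸ S) ↪ X} (hf : ∀ g c, f g (ι c) = ι (g • c)) (g : G) :
        g ∈ S ↔ f g (ι (1 : G)) = ι (1 : G) := by
      rw [← hmk hf, ι.injective.eq_iff, eq_comm, QuotientGroup.eq, inv_one, one_mul]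
    obtain rfl : S = S' := by
      ext g
      rw [hstab hf, hstab hf', h1]
    obtain rfl : ι = ι' := by
      ext c
      obtain ⟨g, rfl⟩ := QuotientGroup.mk_surjective c
      rw [hmk hf, hmk hf', h1]
    rfl
  · rintro ⟨f, x⟩
    let _ : MulAction G X := MulAction.compHom X f
    have hsmul (g : G) (y : X) : g • y = f g y := rfl
    have hinj := MulAction.injective_ofQuotientStabilizer G x
    have : Finite (G ⧸ MulAction.stabilizer G x) := Finite.of_injective _ hinj
    refine ⟨⟨⟨(MulAction.stabilizer G x).index, Finset.mem_Icc.2 ⟨?_, ?_⟩⟩, ⟨_, rfl⟩,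
      ⟨_, hinj⟩, f, fun g c => ?_⟩, ?_⟩
    · exact Nat.one_le_iff_ne_zero.2 (Subgroup.index_ne_zero_iff_finite.2 this)
    · exact Nat.card_le_card_of_injective _ hinj
    · exact (MulAction.ofQuotientStabilizer_smul G x g c).symm
    · exact Prod.ext rfl (one_smul G x)

theorem card_mul_actionCount (n : ℕ) (hhom : ∀ m, Finite (G →* Equiv.Perm (Fin m)))
    (hsub : ∀ d ≠ 0, Finite {S : Subgroup G // S.index = d}) :
    n * actionCount G n = ∑ d ∈ Finset.Icc 1 n, Nat.card {S : Subgroup G // S.index = d} *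
      (n.descFactorial d * actionCount G (n - d)) := by
  classical
  have hX : Nat.card (Fin n) = n := Nat.card_fin n
  have hbij := pointedAction_bijective (G := G) (Fin n)
  rw [hX] at hbij
  have hne (d : Finset.Icc 1 n) : (d : ℕ) ≠ 0 :=
    Nat.one_le_iff_ne_zero.1 (Finset.mem_Icc.1 d.2).1
  have (d : Finset.Icc 1 n) : Finite {S : Subgroup G // S.index = d} := hsub d (hne d)
  have (d : Finset.Icc 1 n) (S : {S : Subgroup G // S.index = d}) : Finite (G ⧸ S.1) :=
    Subgroup.index_ne_zero_iff_finite.1 (S.2.trans_ne (hne d))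
  have := hhom n
  calc n * actionCount G n = Nat.card ((G →* Equiv.Perm (Fin n)) × Fin n) := by
        rw [Nat.card_prod, hX, mul_comm, actionCount]
    _ = _ := by
        rw [← Nat.card_congr (Equiv.ofBijective _ hbij), Nat.card_sigma,
          ← Finset.sum_coe_sort (Finset.Icc 1 n)]
        refine Finset.sum_congr rfl fun d _ => ?_
        have := Fintype.ofFinite {S : Subgroup G // S.index = d}
        have key (S : {S : Subgroup G // S.index = d}) :
            Nat.card (Σ ι : (G ⧸ S.1) ↪ Fin n,
              {f : G →* Equiv.Perm (Fin n) // ∀ g c, f g (ι c) = ι (g • c)}) =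
            n.descFactorial d * actionCount G (n - d) := by
          have := Fintype.ofFinite (G ⧸ S.1)
          have hS : Fintype.card (G ⧸ S.1) = d := by
            rw [← Nat.card_eq_fintype_card]; exact S.2
          rw [Nat.card_sigma]
          have hfib (ι : (G ⧸ S.1) ↪ Fin n) :
              Nat.card {f : G →* Equiv.Perm (Fin n) // ∀ g c, f g (ι c) = ι (g • c)} =
                actionCount G (n - d) := by
            rw [← Nat.card_congr (Equiv.ofBijective _ (extendAction_bijective ι)), card_hom_perm,
              Nat.card_coe_set_eq, Set.ncard_compl, hX, ← Nat.card_coe_set_eq,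
              Nat.card_range_of_injective ι.injective, Nat.card_eq_fintype_card, hS]
          simp [hfib, Fintype.card_embedding_eq, hS]
        rw [Nat.card_sigma, Finset.sum_congr rfl fun S _ => key S]
        simp

end Actions

/-! ### Commuting triples as actions of `ℤ³` -/

section Triples

/-- The images of the standard generators under an action of `ℤ³`. -/
def tripleOfHom {P : Type*} [Group P] (f : Multiplicative ((ℤ × ℤ) × ℤ) →* P) :
    {p : P × P × P // Commute p.1 p.2.1 ∧ Commute p.1 p.2.2 ∧ Commute p.2.1 p.2.2} :=
  ⟨(f (.ofAdd ((1, 0), 0)), f (.ofAdd ((0, 1), 0)), f (.ofAdd ((0, 0), 1))),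
    (Commute.all _ _).map f, (Commute.all _ _).map f, (Commute.all _ _).map f⟩

theorem tripleOfHom_bijective {P : Type*} [Group P] :
    Function.Bijective (tripleOfHom (P := P)) := by
  constructor
  · intro f f' h
    have hgen (f : Multiplicative ((ℤ × ℤ) × ℤ) →* P) (i j k : ℤ) :
        f (.ofAdd ((i, j), k)) = f (.ofAdd ((1, 0), 0)) ^ i * f (.ofAdd ((0, 1), 0)) ^ j *
          f (.ofAdd ((0, 0), 1)) ^ k := by
      rw [← map_zpow f, ← map_zpow f, ← map_zpow f, ← map_mul f, ← map_mul f, ← ofAdd_zsmul, ← ofAdd_zsmul,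
        ← ofAdd_zsmul, ← ofAdd_add, ← ofAdd_add]
      simp
    have h1 := congrArg Subtype.val h
    simp only [tripleOfHom, Prod.mk.injEq] at h1
    refine MonoidHom.ext fun v => ?_
    change f (.ofAdd ((v.toAdd.1.1, v.toAdd.1.2), v.toAdd.2)) =
      f' (.ofAdd ((v.toAdd.1.1, v.toAdd.1.2), v.toAdd.2))
    rw [hgen f, hgen f', h1.1, h1.2.1, h1.2.2]
  · rintro ⟨⟨x, y, z⟩, hxy : Commute x y, hxz : Commute x z, hyz : Commute y z⟩
    refine ⟨MonoidHom.mk' (fun v => x ^ v.toAdd.1.1 * y ^ v.toAdd.1.2 * z ^ v.toAdd.2) ?_, ?_⟩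
    · intro v w
      have h1 := hxy.zpow_zpow w.toAdd.1.1 v.toAdd.1.2
      have h2 := hxz.zpow_zpow w.toAdd.1.1 v.toAdd.2
      have h3 := hyz.zpow_zpow w.toAdd.1.2 v.toAdd.2
      simp only [toAdd_mul, Prod.fst_add, Prod.snd_add, zpow_add]
      rw [h1.mul_mul_mul_comm, (h2.mul_left h3).mul_mul_mul_comm]
    · simp [tripleOfHom]

theorem T_eq_actionCount (n : ℕ) : T n = actionCount (Multiplicative ((ℤ × ℤ) × ℤ)) n :=
  (Nat.card_congr (Equiv.ofBijective _ tripleOfHom_bijective)).symm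

theorem finite_hom_perm (n : ℕ) :
    Finite (Multiplicative ((ℤ × ℤ) × ℤ) →* Equiv.Perm (Fin n)) :=
  Finite.of_injective _ tripleOfHom_bijective.1

/-- Subgroups of index `d` in additive and multiplicative notation. -/
def subgroupMultiplicativeEquiv (A : Type*) [AddGroup A] (d : ℕ) :
    {L : AddSubgroup A // L.index = d} ≃ {S : Subgroup (Multiplicative A) // S.index = d} :=
  AddSubgroup.toSubgroup.toEquiv.subtypeEquiv fun L => by
    rw [← AddSubgroup.index_toSubgroup]; rfl

theorem mul_T_eq_sum (n : ℕ) :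
    n * T n = ∑ d ∈ Finset.Icc 1 n, (∑ a ∈ d.divisors, a * sigmaOne a) *
      (n.descFactorial d * T (n - d)) := by
  have hsub (d : ℕ) (hd : d ≠ 0) :
      Finite {S : Subgroup (Multiplicative ((ℤ × ℤ) × ℤ)) // S.index = d} :=
    have := finite_addSubgroup_int_cubed d hd
    Finite.of_equiv _ (subgroupMultiplicativeEquiv _ d)
  simp only [T_eq_actionCount]
  rw [card_mul_actionCount n finite_hom_perm hsub]
  refine Finset.sum_congr rfl fun d hd => ?_
  rw [← Nat.card_congr (subgroupMultiplicativeEquiv _ d),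
    card_addSubgroup_int_cubed d (Nat.one_le_iff_ne_zero.1 (Finset.mem_Icc.1 hd).1)]

theorem T_zero : T 0 = 1 := by
  rw [T, Nat.card_eq_one_iff_unique]
  exact ⟨inferInstance, ⟨⟨(1, 1, 1), by simp⟩⟩⟩

end Triples

/-! ### The logarithm series and the infinite product -/

section Logarithm

theorem sigmaOne_le_sq (j : ℕ) : sigmaOne j ≤ j ^ 2 := by
  rw [sigmaOne, ArithmeticFunction.sigma_one_apply]
  calc ∑ d ∈ j.divisors, d ≤ ∑ _d ∈ j.divisors, j :=
        Finset.sum_le_sum fun d hd => Nat.divisor_le hd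
    _ ≤ j ^ 2 := by
        rw [Finset.sum_const, smul_eq_mul, sq]
        exact Nat.mul_le_mul_right _ (Nat.card_divisors_le_self j)

/-- The terms of the double series for the logarithm. -/
noncomputable def logTerm (u : ℂ) (p : ℕ+ × ℕ+) : ℂ :=
  ((sigmaOne p.1 : ℂ) / ((p.2 : ℕ) : ℂ)) * u ^ ((p.1 : ℕ) * (p.2 : ℕ))

variable {u : ℂ}

/-- Dropping `1/k` and using `σ(j) ≤ j²` leaves the summable majorant `j² ‖u‖^{jk}`. -/
theorem summable_logTerm (hu : ‖u‖ < 1) : Summable (logTerm u) := by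
  have h := (summable_prod_mul_pow (𝕜 := ℝ) 2 (r := ‖u‖) (by simpa using hu)).prod_symm
  refine Summable.of_norm_bounded h fun p => ?_
  rw [logTerm, norm_mul, norm_div, norm_pow, Complex.norm_natCast, Complex.norm_natCast]
  have h1 : (sigmaOne p.1 : ℝ) ≤ ((p.1 : ℕ) : ℝ) ^ 2 := by exact_mod_cast sigmaOne_le_sq p.1
  have h2 : (1 : ℝ) ≤ ((p.2 : ℕ) : ℝ) := by exact_mod_cast p.2.pos
  simp only [Prod.fst_swap, Prod.snd_swap, mul_comm (p.2 : ℕ)]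
  gcongr
  exact (div_le_self (by positivity) h2).trans h1

/-- On the fibre `jk = d` the coefficient `σ(j)/k` equals `j σ(j)/d`. -/
theorem hasSum_logTerm_divisors (d : ℕ+) :
    HasSum (fun c : Nat.divisorsAntidiagonal d => logTerm u (sigmaAntidiagonalEquivProd ⟨d, c⟩))
      (logCoeff d * u ^ (d : ℕ)) := by
  have hterm (c : Nat.divisorsAntidiagonal d) :
      logTerm u (sigmaAntidiagonalEquivProd ⟨d, c⟩) =
        (sigmaOne c.1.1 : ℂ) / (c.1.2 : ℂ) * u ^ (d : ℕ) := by
    have := (Nat.mem_divisorsAntidiagonal.1 c.2).1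
    simp [logTerm, sigmaAntidiagonalEquivProd, divisorsAntidiagonalFactors, this]
  simp only [hterm]
  convert hasSum_fintype _ using 1
  rw [Finset.sum_coe_sort (Nat.divisorsAntidiagonal d)
    (fun c : ℕ × ℕ => (sigmaOne c.1 : ℂ) / (c.2 : ℂ) * u ^ (d : ℕ)), ← Finset.sum_mul,
    Nat.sum_divisorsAntidiagonal (fun a b => (sigmaOne a : ℂ) / (b : ℂ)), logCoeff]
  congr 1
  refine Finset.sum_congr rfl fun a ha => ?_
  have ha0 : (a : ℂ) ≠ 0 := by exact_mod_cast (Nat.pos_of_mem_divisors ha).ne'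
  rw [Nat.cast_div (Nat.dvd_of_mem_divisors ha) ha0]
  have : (d : ℂ) ≠ 0 := by exact_mod_cast d.ne_zero
  field_simp

theorem hasSum_logCoeff (hu : ‖u‖ < 1) :
    HasSum (fun d : ℕ => logCoeff d * u ^ d) (∑' p, logTerm u p) := by
  have h1 := sigmaAntidiagonalEquivProd.hasSum_iff.2 (summable_logTerm hu).hasSum
  have h2 : HasSum (fun d : ℕ+ => logCoeff d * u ^ (d : ℕ)) (∑' p, logTerm u p) :=
    h1.sigma hasSum_logTerm_divisors
  refine (PNat.coe_injective.hasSum_iff fun d hd => ?_).1 h2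
  have : d = 0 := by
    by_contra h0
    exact hd ⟨⟨d, Nat.pos_of_ne_zero h0⟩, rfl⟩
  simp [this, logCoeff]

theorem logSeries_eq_tsum (hu : ‖u‖ < 1) : logSeries u = ∑' p, logTerm u p :=
  (hasSum_logCoeff hu).tsum_eq

theorem hasSum_logSeries (hu : ‖u‖ < 1) :
    HasSum (fun d : ℕ => logCoeff d * u ^ d) (logSeries u) :=
  logSeries_eq_tsum hu ▸ hasSum_logCoeff hu

theorem hasSum_logTerm (hu : ‖u‖ < 1) : HasSum (logTerm u) (logSeries u) :=
  logSeries_eq_tsum hu ▸ (summable_logTerm hu).hasSum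

theorem norm_pow_pnat_lt_one (hu : ‖u‖ < 1) (j : ℕ+) : ‖u ^ (j : ℕ)‖ < 1 := by
  rw [norm_pow]
  exact pow_lt_one₀ (norm_nonneg _) hu j.ne_zero

theorem hasSum_logTerm_right (hu : ‖u‖ < 1) (j : ℕ+) :
    HasSum (fun k => logTerm u (j, k)) (sigmaOne j * -Complex.log (1 - u ^ (j : ℕ))) := by
  have h := (Complex.hasSum_taylorSeries_neg_log' (norm_pow_pnat_lt_one hu j)).mul_left
    (sigmaOne j : ℂ)
  -- The Taylor series is indexed by `n : ℕ` with `k = n + 1`.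
  refine (Equiv.pnatEquivNat.symm.hasSum_iff).1 (h.congr_fun fun n => ?_)
  simp [logTerm, pow_mul]
  ring

theorem exp_mul_neg_log_eq_factor (hu : ‖u‖ < 1) (j : ℕ+) :
    Complex.exp (sigmaOne j * -Complex.log (1 - u ^ (j : ℕ))) = factor u j := by
  have h0 : 1 - u ^ (j : ℕ) ≠ 0 := by
    intro h
    have := norm_pow_pnat_lt_one hu j
    rw [← sub_eq_zero.1 h, norm_one] at this
    exact lt_irrefl _ this
  rw [Complex.exp_nat_mul, Complex.exp_neg, Complex.exp_log h0, factor, zpow_neg, zpow_natCast,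
    inv_pow]

theorem hasProd_factor (hu : ‖u‖ < 1) :
    HasProd (factor u) (Complex.exp (logSeries u)) := by
  have h := ((hasSum_logTerm hu).prod_fiberwise (hasSum_logTerm_right hu)).cexp
  exact h.congr_fun fun j => (exp_mul_neg_log_eq_factor hu j).symm

theorem productSide_eq_exp (hu : ‖u‖ < 1) : productSide u = Complex.exp (logSeries u) :=
  (hasProd_factor hu).tprod_eq

theorem natCast_mul_logCoeff (d : ℕ) (hd : d ≠ 0) :
    (d : ℂ) * logCoeff d = ((∑ a ∈ d.divisors, a * sigmaOne a : ℕ) : ℂ) := by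
  have : (d : ℂ) ≠ 0 := by exact_mod_cast hd
  rw [logCoeff, ← Finset.sum_div, mul_div_cancel₀ _ this]
  push_cast
  rfl

theorem one_le_norm_logCoeff (d : ℕ) (hd : d ≠ 0) : 1 ≤ ‖logCoeff d‖ := by
  have hpos : (0 : ℝ) < d := by exact_mod_cast Nat.pos_of_ne_zero hd
  have h := congrArg norm (natCast_mul_logCoeff d hd)
  rw [norm_mul, Complex.norm_natCast, Complex.norm_natCast] at h
  have hσ : 1 ≤ sigmaOne d := by
    rw [sigmaOne, ArithmeticFunction.sigma_one_apply]
    exact (Nat.pos_of_ne_zero hd).trans_le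
      (Finset.single_le_sum (f := fun a => a) (by simp) (Nat.mem_divisors_self d hd))
  have hle : d ≤ ∑ a ∈ d.divisors, a * sigmaOne a :=
    (Nat.le_mul_of_pos_right d hσ).trans
      (Finset.single_le_sum (f := fun a => a * sigmaOne a) (by simp)
        (Nat.mem_divisors_self d hd))
  have hle' : (d : ℝ) ≤ d * ‖logCoeff d‖ := by
    rw [h]; exact_mod_cast hle
  exact le_of_mul_le_mul_left (by simpa using hle') hpos

theorem radius_logCoeff : (FormalMultilinearSeries.ofScalars ℂ logCoeff).radius = 1 := by
  apply le_antisymm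
  -- A radius above `1` would force the coefficients to tend to `0`, but their norms are at least
  -- `1` for `d ≥ 1`.
  · by_contra! h
    have h1 := (FormalMultilinearSeries.summable_norm_mul_pow _ (r := 1) (by simpa using h))
    have h2 := h1.tendsto_atTop_zero
    simp only [FormalMultilinearSeries.ofScalars_norm, NNReal.coe_one, one_pow, mul_one] at h2
    have h3 := ge_of_tendsto h2 (b := 1)
      (Filter.eventually_atTop.2 ⟨1, fun d hd => one_le_norm_logCoeff d (by omega)⟩)
    norm_num at h3
  · refine ENNReal.le_of_forall_nnreal_lt fun r hr => ?_
    have hr1 : (r : ℝ) < 1 := by exact_mod_cast hr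
    apply FormalMultilinearSeries.le_radius_of_summable
    have h := (hasSum_logSeries (u := (r : ℂ)) (by simpa using hr1)).summable.norm
    simpa [FormalMultilinearSeries.ofScalars_norm] using h

theorem hasFPowerSeriesOnBall_logSeries :
    HasFPowerSeriesOnBall logSeries (FormalMultilinearSeries.ofScalars ℂ logCoeff) 0 1 := by
  have h := (FormalMultilinearSeries.ofScalars ℂ logCoeff).hasFPowerSeriesOnBall
    (by rw [radius_logCoeff]; exact one_pos)
  rw [radius_logCoeff] at h
  convert h using 1
  ext u
  exact tsum_congr fun n => by simp [mul_comm]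

theorem analyticOnNhd_logSeries : AnalyticOnNhd ℂ logSeries (Metric.ball 0 1) := by
  have h := hasFPowerSeriesOnBall_logSeries.analyticOnNhd
  rwa [← ENNReal.ofReal_one, Metric.eball_ofReal] at h

theorem iteratedDeriv_logSeries (n : ℕ) : iteratedDeriv n logSeries 0 = n ! * logCoeff n := by
  have h := hasFPowerSeriesOnBall_logSeries.factorial_smul 1 n
  rw [iteratedDeriv_eq_iteratedFDeriv, ← h]
  simp

end Logarithm

/-! ### Matching the recursions, and growth -/

section Exponential

theorem productSide_eqOn :
    Set.EqOn productSide (fun u => Complex.exp (logSeries u)) (Metric.ball 0 1) :=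
  fun _ hu => productSide_eq_exp (mem_ball_zero_iff.1 hu)

theorem analyticOnNhd_productSide : AnalyticOnNhd ℂ productSide (Metric.ball 0 1) :=
  analyticOnNhd_logSeries.cexp.congr Metric.isOpen_ball productSide_eqOn.symm

theorem deriv_productSide_eventuallyEq :
    deriv productSide =ᶠ[nhds 0] fun u => productSide u * deriv logSeries u := by
  filter_upwards [Metric.isOpen_ball.mem_nhds (Metric.mem_ball_self (x := (0 : ℂ)) one_pos)]
    with u hu
  have hd := (analyticOnNhd_logSeries u hu).differentiableAt.hasDerivAt.cexp
  rw [(productSide_eqOn.eventuallyEq_of_mem (Metric.isOpen_ball.mem_nhds hu)).deriv_eq, hd.deriv,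
    productSide_eqOn hu]

theorem iteratedDeriv_succ_productSide (n : ℕ) :
    iteratedDeriv (n + 1) productSide 0 = ∑ i ∈ Finset.range (n + 1),
      (n.choose i : ℂ) * iteratedDeriv i productSide 0 *
        ((n - i + 1)! * logCoeff (n - i + 1)) := by
  have h0 : (0 : ℂ) ∈ Metric.ball (0 : ℂ) 1 := Metric.mem_ball_self one_pos
  rw [iteratedDeriv_succ', deriv_productSide_eventuallyEq.iteratedDeriv_eq,
    iteratedDeriv_fun_mul (analyticOnNhd_productSide 0 h0).contDiffAt
      (analyticOnNhd_logSeries 0 h0).deriv.contDiffAt]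
  refine Finset.sum_congr rfl fun i _ => ?_
  rw [← iteratedDeriv_logSeries, iteratedDeriv_succ']

/-- The marked-point recursion in Leibniz form, with `i = n + 1 - d`. For `d = k + 1` the falling
factorial is `(n+1) · k! · C(n,k)`, so `n + 1` cancels, and the factor `d` in `s(d) = d · logCoeff
d` turns `k!` into `(k+1)!`. -/
theorem T_succ (n : ℕ) :
    (T (n + 1) : ℂ) = ∑ i ∈ Finset.range (n + 1),
      (n.choose i : ℂ) * T i * ((n - i + 1)! * logCoeff (n - i + 1)) := by
  have h := congrArg (Nat.cast : ℕ → ℂ) (mul_T_eq_sum (n + 1))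
  have hn : ((n + 1 : ℕ) : ℂ) ≠ 0 := by exact_mod_cast n.succ_ne_zero
  apply mul_left_cancel₀ hn
  rw [← Nat.cast_mul, h, Nat.cast_sum, Finset.mul_sum]
  refine Finset.sum_bij' (fun d _ => n + 1 - d) (fun i _ => n + 1 - i) ?_ ?_ ?_ ?_ ?_
  · intro d hd; simp at hd ⊢; omega
  · intro d hd; simp at hd ⊢; omega
  · intro d hd; simp at hd ⊢; omega
  · intro d hd; simp at hd ⊢; omega
  · intro d hd
    obtain ⟨h1, h2⟩ := Finset.mem_Icc.1 hd
    obtain ⟨k, rfl⟩ := Nat.exists_eq_add_of_le' h1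
    have hk : k ≤ n := by omega
    rw [Nat.cast_mul, ← natCast_mul_logCoeff _ k.succ_ne_zero, Nat.add_sub_add_right,
      Nat.sub_sub_self hk, Nat.choose_symm hk, Nat.succ_descFactorial_succ,
      Nat.descFactorial_eq_factorial_mul_choose, Nat.factorial_succ]
    push_cast
    ring

theorem iteratedDeriv_productSide (n : ℕ) : iteratedDeriv n productSide 0 = T n := by
  induction n using Nat.strong_induction_on with
  | _ n ih =>
    cases n with
    | zero =>
      rw [iteratedDeriv_zero, productSide_eq_exp (by simp), T_zero, logSeries,
        tsum_eq_single 0 fun d hd => by simp [hd]]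
      simp [logCoeff]
    | succ n =>
      rw [iteratedDeriv_succ_productSide, T_succ]
      exact Finset.sum_congr rfl fun i hi => by rw [ih i (Finset.mem_range.1 hi)]

theorem hasSum_T {u : ℂ} (hu : ‖u‖ < 1) :
    HasSum (fun n : ℕ => ((T n : ℂ) / (n ! : ℂ)) * u ^ n) (productSide u) := by
  have h := Complex.hasSum_taylorSeries_on_ball
    analyticOnNhd_productSide.differentiableOn (mem_ball_zero_iff.2 hu)
  refine h.congr_fun fun n => ?_
  rw [iteratedDeriv_productSide, sub_zero, smul_eq_mul, smul_eq_mul]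
  ring

theorem subexponentialGrowth_T :
    SubexponentialGrowth (fun n : ℕ => (T n : ℝ) / (n ! : ℝ)) := by
  intro c hc
  have hc0 : 0 < c := one_pos.trans hc
  -- At `u = 1/c` the series converges, so its terms `T(n) / (n! cⁿ)` tend to `0`.
  have hu : ‖((c⁻¹ : ℝ) : ℂ)‖ < 1 := by
    rw [Complex.norm_real, Real.norm_of_nonneg (inv_nonneg.2 hc0.le)]
    exact inv_lt_one_of_one_lt₀ hc
  rw [Asymptotics.isLittleO_iff_tendsto fun n h => absurd h (pow_pos hc0 n).ne']
  have h := (hasSum_T hu).summable.tendsto_atTop_zero.norm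
  rw [norm_zero] at h
  refine h.congr fun n => ?_
  rw [norm_mul, norm_div, norm_pow, Complex.norm_natCast, Complex.norm_natCast, Complex.norm_real,
    Real.norm_of_nonneg (inv_nonneg.2 hc0.le), inv_pow, div_eq_mul_inv _ (c ^ n)]

end Exponential

end CommutingTriples

theorem mainTheorem2 :
    -- the product converges (to a nonzero limit) on the open unit disc
    (∀ u : ℂ, ‖u‖ < 1 →
      Multipliable (CommutingTriples.factor u) ∧ CommutingTriples.productSide u ≠ 0) ∧
    -- the power series converges there, to the same value
    (∀ u : ℂ, ‖u‖ < 1 →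
      HasSum (fun n : ℕ => ((CommutingTriples.T n : ℂ) / (n ! : ℂ)) * u ^ n)
        (CommutingTriples.productSide u)) ∧
    -- the common value is analytic on the disc, and the power series is its Taylor series at `0`
    AnalyticOnNhd ℂ CommutingTriples.productSide (Metric.ball 0 1) ∧
    (∀ n : ℕ, iteratedDeriv n CommutingTriples.productSide 0 / (n ! : ℂ) =
      (CommutingTriples.T n : ℂ) / (n ! : ℂ)) ∧
    -- the logarithm series has radius of convergence exactly `1`
    (FormalMultilinearSeries.ofScalars ℂ CommutingTriples.logCoeff).radius = 1 ∧
    -- on the disc it equals the double series, and it is a logarithm of the product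
    (∀ u : ℂ, ‖u‖ < 1 →
      HasSum (fun d : ℕ => CommutingTriples.logCoeff d * u ^ d) (CommutingTriples.logSeries u) ∧
      HasSum (fun p : ℕ+ × ℕ+ =>
        ((CommutingTriples.sigmaOne p.1 : ℂ) / ((p.2 : ℕ) : ℂ)) * u ^ ((p.1 : ℕ) * (p.2 : ℕ)))
        (CommutingTriples.logSeries u) ∧
      Complex.exp (CommutingTriples.logSeries u) = CommutingTriples.productSide u) ∧
    -- growth of `T(n) / n!`
    CommutingTriples.SubexponentialGrowth
      (fun n : ℕ => (CommutingTriples.T n : ℝ) / (n ! : ℝ)) := by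
  open CommutingTriples in
  exact ⟨fun u hu => ⟨(hasProd_factor hu).multipliable,
      productSide_eq_exp hu ▸ Complex.exp_ne_zero _⟩,
    fun u hu => hasSum_T hu, analyticOnNhd_productSide,
    fun n => by rw [iteratedDeriv_productSide], radius_logCoeff,
    fun u hu => ⟨hasSum_logSeries hu, hasSum_logTerm hu, (productSide_eq_exp hu).symm⟩,
    subexponentialGrowth_T⟩
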